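/- **Theorem (online DR-submodular maximization over the hypercube).** There is an absolute constant $C>0$ such that the following holds for every dimension $n$, every horizon $T\ge 2$ and every $G\ge 0$. Let $F^1,\dots,F^T:[0,1]^n\to[0,1]$ be functions that are $G$-Lipschitz in the Euclidean norm and DR-submodular, i.e. $$F(x+ae_i)-F(x)\le F(y+ae_i)-F(y)$$ whenever $y\le x$ coordinatewise, $a>0$, $1\le i\le n$ and $x,\ y,\ x+ae_i,\ y+ae_i\in[0,1]^n$. (They need not be monotone.) Let $M=\lceil\log_2 T\rceil$ and $N=n(M+1)$. *Lifting.* Let $w_0=2^{-M}$ and $w_j=2^{-j}$ for $1\le j\le M$, so that $\sum_{j=0}^M w_j=1$. A set $S\subseteq\{1,\dots,n\}\times\{0,\dots,M\}$, i.e. a vertex $\mathbf 1_S$ of $\{0,1\}^{N}$, represents the point $x(S)\in\{0,2^{-M},2\cdot2^{-M},\dots,1\}^n$ with $x(S)_i=\sum_{j:(i,j)\in S}w_j$. Put $\tilde f^t(S)=F^t(x(S))$. *Roughgarden–Wang algorithm on $\{0,1\}^{N}$.* Order the ground set $\{1,\dots,n\}\times\{0,\dots,M\}$ lexicographically. Every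 element $v$ keeps a probability $p_v\in[0,1]$, initially $\tfrac12$. In each round a set $S$ is drawn that contains each $v$ independently with probability $p_v$. When the function $\tilde f$ of the round is revealed, let, for each $v$, $X_v=\{u\in S:u<v\}$, $Y_v=X_v\cup\{u:u\ge v\}$, $\alpha_v=\tilde f(X_v\cup\{v\})-\tilde f(X_v)$, $\beta_v=\tilde f(Y_v\setminus\{v\})-\tilde f(Y_v)$, and replace $p_v$ by $p_v+\frac{(1-p_v)\alpha_v-p_v\beta_v}{2\sqrt T}$, truncated to $[0,1]$. *Algorithm on $[0,1]^n$.* In round $1$ play an arbitrary point $x^1\in[0,1]^n$. For $1\le t<T$, after $F^1,\dots,F^t$ have been revealed, let $S^{t+1}$ be the random set that the Roughgarden–Wang algorithm draws in round $t+1$ after having processed $\tilde f^1,\dots,\tilde f^t$, and play $x^{t+1}=x(S^{t+1})$. Then the maximum of $\sum_{t=1}^T F^t$ over $[0,1]^n$ is attained and, whatever $x^1$ is, $$\mathbb E\Bigl[\sum_{t=1}^T F^t(x^t)\Bigr]\ \ge\ \frac12\max_{x\in[0,1]^n}\sum_{t=1}^T F^t(x)\ -\ C\,n\,\max\{1,G\}\,\sqrt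 T\,\log T .$$ -/

import Mathlib

namespace OnlineDR

/-- The hypercube `[0,1]^n` in Euclidean space. -/
def cube (n : ℕ) : Set (EuclideanSpace ℝ (Fin n)) :=
  {x | ∀ i, x i ∈ Set.Icc (0 : ℝ) 1}

/-- Diminishing-return submodularity of `F` on `[0,1]^n`. -/
def DRSubmodular {n : ℕ} (F : EuclideanSpace ℝ (Fin n) → ℝ) : Prop :=
  ∀ x ∈ cube n, ∀ y ∈ cube n, (∀ j, y j ≤ x j) → ∀ (i : Fin n) (a : ℝ), 0 < a →
    x + EuclideanSpace.single i a ∈ cube n → y + EuclideanSpace.single i a ∈ cube n →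
    F (x + EuclideanSpace.single i a) - F x ≤ F (y + EuclideanSpace.single i a) - F y

/-! ### Lifting to `{0,1}^{n(M+1)}`

A vertex of `{0,1}^{n(M+1)}` is the indicator of a set `S : Finset (Fin (n * (M + 1)))`; its
coordinate `(i, j)` is the membership of `finProdFinEquiv (i, j)` in `S`. -/

/-- The weight of the `j`-th bit: `2^{-j}` for `1 ≤ j ≤ M`, and `2^{-M}` for the extra bit `j = 0`.
These weights add up to `1`, so every vertex is decoded to a point of `[0,1]^n`, and every multiple
of `2^{-M}` in `[0,1]` is a sum of some of them. -/
noncomputable def bitWeight (M : ℕ) (j : Fin (M + 1)) : ℝ :=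
  if j = 0 then (1 / 2) ^ M else (1 / 2) ^ (j : ℕ)

/-- The point `x` of the lattice `{0, 2^{-M}, …, 1}^n` represented by a vertex of the lifted cube:
`x_i` is the sum of the weights of the bits `(i, j)` that are set. -/
noncomputable def decode (n M : ℕ) (S : Finset (Fin (n * (M + 1)))) : EuclideanSpace ℝ (Fin n) :=
  WithLp.toLp 2 fun i =>
    ∑ j : Fin (M + 1), if finProdFinEquiv (i, j) ∈ S then bitWeight M j else 0

/-- The lifted set function of `F`. -/
noncomputable def liftFn (n M : ℕ) (F : EuclideanSpace ℝ (Fin n) → ℝ)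
    (S : Finset (Fin (n * (M + 1)))) : ℝ :=
  F (decode n M S)

/-! ### The Roughgarden–Wang algorithm for online submodular maximization on `{0,1}^N`

The algorithm runs the bi-greedy pass over the ground set `Fin N`, where the decision about the
element `v` is made by a two-action learner attached to `v`. The state of the learner is the
probability `p v` with which `v` is picked. -/

theorem sum_prod_ite_eq_one {N : ℕ} (p : Fin N → unitInterval) :
    ∑ S : Finset (Fin N),
      ENNReal.ofReal (∏ v, if v ∈ S then (p v : ℝ) else 1 - (p v : ℝ)) = 1 := by
  have h0 : ∀ S : Finset (Fin N), 0 ≤ ∏ v, (if v ∈ S then (p v : ℝ) else 1 - (p v : ℝ)) := by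
    intro S
    refine Finset.prod_nonneg fun v _ => ?_
    split_ifs
    · exact (p v).2.1
    · linarith [(p v).2.2]
  rw [← ENNReal.ofReal_sum_of_nonneg fun S _ => h0 S]
  have h1 := Finset.prod_add (fun v => (p v : ℝ)) (fun v => 1 - (p v : ℝ))
    (Finset.univ : Finset (Fin N))
  simp only [add_sub_cancel, Finset.prod_const_one, Finset.powerset_univ] at h1
  rw [← ENNReal.ofReal_one]
  congr 1
  refine Eq.trans (Finset.sum_congr rfl fun S _ => ?_) h1.symm
  rw [Finset.prod_ite]
  congr 1
  · exact Finset.prod_congr (by ext; simp) fun _ _ => rfl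
  · exact Finset.prod_congr (by ext; simp) fun _ _ => rfl

/-- The law of the random set that contains each `v` independently with probability `p v`. -/
noncomputable def pickLaw {N : ℕ} (p : Fin N → unitInterval) : PMF (Finset (Fin N)) :=
  PMF.ofFintype
    (fun S => ENNReal.ofReal (∏ v, if v ∈ S then (p v : ℝ) else 1 - (p v : ℝ)))
    (sum_prod_ite_eq_one p)

/-- Marginal value, for the set function `f`, of adding `v` to the lower set `X` of the bi-greedy
pass, where `X` consists of the elements before `v` that were picked. -/
def gainAdd {N : ℕ} (f : Finset (Fin N) → ℝ) (S : Finset (Fin N)) (v : Fin N) : ℝ :=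
  f (insert v (S ∩ Finset.Iio v)) - f (S ∩ Finset.Iio v)

/-- Marginal value, for the set function `f`, of removing `v` from the upper set `Y` of the
bi-greedy pass, where `Y` consists of the elements before `v` that were picked, of `v`, and of all
elements after `v`. -/
def gainRemove {N : ℕ} (f : Finset (Fin N) → ℝ) (S : Finset (Fin N)) (v : Fin N) : ℝ :=
  f ((S ∩ Finset.Iio v) ∪ Finset.Ioi v) - f ((S ∩ Finset.Iio v) ∪ Finset.Ici v)

/-- The initial state: every learner picks its element with probability `1/2`. -/
noncomputable def rwInit (N : ℕ) : Fin N → unitInterval :=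
  fun _ => ⟨1 / 2, by norm_num, by norm_num⟩

/-- End of a round with horizon `T`: after the set `S` was played and `f` was revealed, the learner
of each `v` receives `α = gainAdd f S v` and `β = gainRemove f S v`, and moves `p v` by
`((1 - p v) α - p v β) / (2 √T)`, truncated to `[0,1]`. -/
noncomputable def rwUpdate {N : ℕ} (T : ℕ) (f : Finset (Fin N) → ℝ) (p : Fin N → unitInterval)
    (S : Finset (Fin N)) : Fin N → unitInterval :=
  fun v => Set.projIcc (0 : ℝ) 1 zero_le_one
    ((p v : ℝ) + ((1 - (p v : ℝ)) * gainAdd f S v - (p v : ℝ) * gainRemove f S v) /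
      (2 * Real.sqrt T))

/-- The law of the state after `t` rounds in which `f 0, …, f (t - 1)` were revealed. -/
noncomputable def rwStateLaw {N : ℕ} (T : ℕ) (f : ℕ → Finset (Fin N) → ℝ) :
    ℕ → PMF (Fin N → unitInterval)
  | 0 => PMF.pure (rwInit N)
  | t + 1 => (rwStateLaw T f t).bind fun p => (pickLaw p).map (rwUpdate T (f t) p)

/-- The law of the set that the algorithm returns when `f 0, …, f (t - 1)` have been revealed. -/
noncomputable def rwLaw {N : ℕ} (T : ℕ) (f : ℕ → Finset (Fin N) → ℝ) (t : ℕ) :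
    PMF (Finset (Fin N)) :=
  (rwStateLaw T f t).bind pickLaw

/-! ### The algorithm on the hypercube -/

/-- The expected reward `𝔼[F t (x t)]` in round `t` (rounds are counted from `0`). In round `0` the
algorithm plays the given point `x₀`. In round `t + 1` it plays the point represented by the random
set that the Roughgarden–Wang algorithm returns for the lifted functions of `F 0, …, F t`. -/
noncomputable def expectedReward (n M T : ℕ) (F : ℕ → EuclideanSpace ℝ (Fin n) → ℝ)
    (x₀ : EuclideanSpace ℝ (Fin n)) : ℕ → ℝ
  | 0 => F 0 x₀
  | t + 1 => ∑ S : Finset (Fin (n * (M + 1))),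
      (rwLaw T (fun s => liftFn n M (F s)) (t + 1) S).toReal * F (t + 1) (decode n M S)

end OnlineDR

/-!
The proof reduces the hypercube to the Boolean cube and bounds the regret there by a potential
argument.

For a submodular `f : {0,1}^N → [0,1]` and a comparison set `A`, follow the sets that agree with the
drawn set `S` on the first `k` elements and with `A` on the others (`hybrid`). For `A = ∅` and
`A = univ` they are the lower and the upper set of the bi-greedy pass. Telescoping over `k` bounds
`2 f(S) - f(A)` from below by a sum over `v` (`sum_stepGain_le`) in which only `α = gainAdd`,
`β = gainRemove` and the decision about `v` occur. That decision is independent of `α` and `β`, so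
in the mean it may be replaced by `p = p v`.

It remains to bound the regret of a single learner, for example
`(1 - p) α - (p α + (1 - p) β) / 2` when `v ∈ A`. Submodularity gives `α + β ≥ 0`, and under this
constraint the expression is at most `2 (3/4 - p) g`, where `g = (1 - p) α - p β` is the direction
in which the learner moves; for `v ∉ A` the same holds with `1/4` (`regret_of_mem`,
`regret_of_notMem`). Hence the learner is projected gradient ascent compared with the point `3/4` or
`1/4`, and the squared distance to that point is a potential (`two_mul_sub_mul_le`). With step size
`1 / (2 √T)` each learner loses `O(√T)` in total. All quantities in the resulting inequality for one
round (`round_inequality`) are nonnegative, so it is averaged over the random state with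
expectations in `[0, ∞]`, and `rwLaw_regret` follows with regret `O(N √T)`.

The lifted functions are submodular since adding a bit moves the decoded point along a coordinate
direction (`DRSubmodular.setSubmodular_liftFn`). By binary expansion a maximizer over the cube is
within `n 2^{-M} ≤ n / T` of a decoded point (`exists_decode_near`), which costs at most `n G` over
all rounds, and `N = n (M + 1) = O(n log T)`.
-/

open Finset
open scoped ENNReal

namespace OnlineDR

/-! ### Double greedy on a fixed set function -/

/-- Submodularity of a set function, in the form of diminishing marginal values. -/
def SetSubmodular {N : ℕ} (f : Finset (Fin N) → ℝ) : Prop :=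
  ∀ A B : Finset (Fin N), A ⊆ B → ∀ v ∉ B, f (insert v B) - f B ≤ f (insert v A) - f A

/-- The probability of drawing `S` when each `v` is picked independently with probability `p v`. -/
noncomputable def pickWeight {N : ℕ} (p : Fin N → unitInterval) (S : Finset (Fin N)) : ℝ :=
  ∏ v, if v ∈ S then (p v : ℝ) else 1 - (p v : ℝ)

theorem pickWeight_nonneg {N : ℕ} (p : Fin N → unitInterval) (S : Finset (Fin N)) :
    0 ≤ pickWeight p S := by
  refine Finset.prod_nonneg fun v _ => ?_
  split_ifs
  · exact (p v).2.1
  · linarith [(p v).2.2]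

theorem sum_pickWeight {N : ℕ} (p : Fin N → unitInterval) : ∑ S, pickWeight p S = 1 := by
  have h := sum_prod_ite_eq_one p
  change ∑ S, ENNReal.ofReal (pickWeight p S) = 1 at h
  rw [← ENNReal.ofReal_sum_of_nonneg fun S _ => pickWeight_nonneg p S] at h
  simpa using h

theorem pickWeight_eq_mul_prod_erase {N : ℕ} (p : Fin N → unitInterval) (S : Finset (Fin N))
    (v : Fin N) :
    pickWeight p S = (if v ∈ S then (p v : ℝ) else 1 - (p v : ℝ)) *
      ∏ u ∈ univ.erase v, if u ∈ S then (p u : ℝ) else 1 - (p u : ℝ) :=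
  (Finset.mul_prod_erase univ _ (mem_univ v)).symm

/-- The event `v ∈ S` is independent of the elements of `S` before `v`: in the mean, its indicator
may be replaced by `p v`. -/
theorem sum_pickWeight_mul_indicator {N : ℕ} (p : Fin N → unitInterval) (v : Fin N)
    (h : Finset (Fin N) → ℝ) :
    ∑ S, pickWeight p S * (((if v ∈ S then 1 else 0) - (p v : ℝ)) * h (S ∩ Iio v)) = 0 := by
  -- Toggling the membership of `v` pairs the terms off.
  refine Finset.sum_involution (fun S _ => if v ∈ S then S.erase v else insert v S) ?_ ?_
    (fun _ _ => mem_univ _) ?_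
  · intro S _
    have hp : ∀ A B : Finset (Fin N), (∀ u ≠ v, u ∈ A ↔ u ∈ B) →
        ∏ u ∈ univ.erase v, (if u ∈ A then (p u : ℝ) else 1 - (p u : ℝ)) =
        ∏ u ∈ univ.erase v, if u ∈ B then (p u : ℝ) else 1 - (p u : ℝ) := by
      intro A B hAB
      refine Finset.prod_congr rfl fun u hu => ?_
      simp only [hAB u (Finset.ne_of_mem_erase hu)]
    by_cases hv : v ∈ S
    · have hI : S.erase v ∩ Iio v = S ∩ Iio v := by
        ext u; simp only [mem_inter, mem_erase, mem_Iio]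
        exact ⟨fun h => ⟨h.1.2, h.2⟩, fun h => ⟨⟨h.2.ne, h.1⟩, h.2⟩⟩
      simp only [hv, if_true, pickWeight_eq_mul_prod_erase p _ v, hI, mem_erase, ne_eq,
        not_true_eq_false, false_and, if_false]
      rw [hp S (S.erase v) (fun u hu => by simp [hu])]
      simp only [mem_erase]
      ring
    · have hI : insert v S ∩ Iio v = S ∩ Iio v := by
        ext u; simp only [mem_inter, mem_insert, mem_Iio]
        exact ⟨fun h => ⟨h.1.resolve_left h.2.ne, h.2⟩, fun h => ⟨Or.inr h.1, h.2⟩⟩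
      simp only [hv, if_false, pickWeight_eq_mul_prod_erase p _ v, hI, mem_insert_self, if_true]
      rw [hp S (insert v S) (fun u hu => by simp [hu])]
      ring
  · intro S _ _ heq
    by_cases hv : v ∈ S
    · rw [if_pos hv] at heq
      exact Finset.notMem_erase v S (heq.symm ▸ hv)
    · rw [if_neg hv] at heq
      exact hv (heq ▸ mem_insert_self v S)
  · intro S _
    by_cases hv : v ∈ S
    · simp [hv]
    · simp [hv]

/-- The set that agrees with `S` on the first `k` elements of the ground set and with `A` on the
others. For `A = ∅` and `A = univ` it is the lower and the upper set of the bi-greedy pass. -/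
def hybrid {N : ℕ} (S A : Finset (Fin N)) (k : ℕ) : Finset (Fin N) :=
  {u | if (u : ℕ) < k then u ∈ S else u ∈ A}

theorem mem_hybrid {N : ℕ} {S A : Finset (Fin N)} {k : ℕ} {u : Fin N} :
    u ∈ hybrid S A k ↔ if (u : ℕ) < k then u ∈ S else u ∈ A := by
  simp [hybrid]

theorem sum_hybrid_sub {N : ℕ} (f : Finset (Fin N) → ℝ) (S A : Finset (Fin N)) :
    ∑ v : Fin N, (f (hybrid S A (v + 1)) - f (hybrid S A v)) = f S - f A := by
  rw [Fin.sum_univ_eq_sum_range (fun k => f (hybrid S A (k + 1)) - f (hybrid S A k)) N,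
    Finset.sum_range_sub (fun k => f (hybrid S A k))]
  congr 2 <;> ext u <;> simp [mem_hybrid]

theorem hybrid_succ_of_iff {N : ℕ} {S A : Finset (Fin N)} {v : Fin N} (h : v ∈ S ↔ v ∈ A) :
    hybrid S A (v + 1) = hybrid S A v := by
  ext u
  simp only [mem_hybrid]
  rcases lt_trichotomy (u : ℕ) v with h1 | h1 | h1
  · simp [h1, Nat.lt_succ_of_lt h1]
  · obtain rfl := Fin.ext h1
    simpa using h
  · simp [not_lt.2 h1.le, not_lt.2 (Nat.succ_le_of_lt h1)]

theorem hybrid_succ_of_mem {N : ℕ} {S : Finset (Fin N)} (A : Finset (Fin N)) {v : Fin N}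
    (h : v ∈ S) : hybrid S A (v + 1) = insert v (hybrid S A v) := by
  ext u
  simp only [mem_hybrid, mem_insert]
  rcases lt_trichotomy (u : ℕ) v with h1 | h1 | h1
  · have : u ≠ v := fun e => by simp [e] at h1
    simp [h1, Nat.lt_succ_of_lt h1, this]
  · obtain rfl := Fin.ext h1
    simpa using h
  · have : u ≠ v := fun e => by simp [e] at h1
    simp [not_lt.2 h1.le, not_lt.2 (Nat.succ_le_of_lt h1), this]

theorem hybrid_succ_of_notMem {N : ℕ} {S A : Finset (Fin N)} {v : Fin N}
    (h : v ∉ S) (hA : v ∈ A) : hybrid S A v = insert v (hybrid S A (v + 1)) := by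
  ext u
  simp only [mem_hybrid, mem_insert]
  rcases lt_trichotomy (u : ℕ) v with h1 | h1 | h1
  · have : u ≠ v := fun e => by simp [e] at h1
    simp [h1, Nat.lt_succ_of_lt h1, this]
  · obtain rfl := Fin.ext h1
    simpa using hA
  · have : u ≠ v := fun e => by simp [e] at h1
    simp [not_lt.2 h1.le, not_lt.2 (Nat.succ_le_of_lt h1), this]

theorem hybrid_empty {N : ℕ} (S : Finset (Fin N)) (v : Fin N) : hybrid S ∅ v = S ∩ Iio v := by
  ext u
  simp only [mem_hybrid, mem_inter, mem_Iio, Fin.lt_def, notMem_empty]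
  split_ifs <;> simp [*]

theorem hybrid_univ {N : ℕ} (S : Finset (Fin N)) (v : Fin N) :
    hybrid S univ v = (S ∩ Iio v) ∪ Ici v := by
  ext u
  simp only [mem_hybrid, mem_union, mem_inter, mem_Iio, mem_Ici, Fin.lt_def, Fin.le_def, mem_univ]
  split_ifs with h
  · simp [h, -Fin.val_fin_le, not_le.2 h]
  · simp [-Fin.val_fin_le, not_lt.1 h]

theorem hybrid_univ_succ {N : ℕ} {S : Finset (Fin N)} {v : Fin N} (hv : v ∉ S) :
    hybrid S univ (v + 1) = (S ∩ Iio v) ∪ Ioi v := by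
  ext u
  simp only [mem_hybrid, mem_union, mem_inter, mem_Iio, mem_Ioi, Fin.lt_def, mem_univ]
  rcases lt_trichotomy (u : ℕ) v with h1 | h1 | h1
  · simp [h1, -Fin.val_fin_lt, Nat.lt_succ_of_lt h1, not_lt.2 h1.le]
  · obtain rfl := Fin.ext h1
    simpa using hv
  · simp [h1, not_lt.2 (Nat.succ_le_of_lt h1)]

/-- The lower set of the pass moves by `gainAdd` exactly when `v` is picked. -/
theorem hybrid_empty_step {N : ℕ} (f : Finset (Fin N) → ℝ) (S : Finset (Fin N)) (v : Fin N) :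
    f (hybrid S ∅ (v + 1)) - f (hybrid S ∅ v) = (if v ∈ S then 1 else 0) * gainAdd f S v := by
  by_cases hv : v ∈ S
  · rw [hybrid_succ_of_mem ∅ hv, hybrid_empty, if_pos hv, one_mul, gainAdd]
  · rw [hybrid_succ_of_iff (by simp [hv]), if_neg hv]; ring

/-- The upper set of the pass moves by `gainRemove` exactly when `v` is not picked. -/
theorem hybrid_univ_step {N : ℕ} (f : Finset (Fin N) → ℝ) (S : Finset (Fin N)) (v : Fin N) :
    f (hybrid S univ (v + 1)) - f (hybrid S univ v) =
      (1 - if v ∈ S then 1 else 0) * gainRemove f S v := by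
  by_cases hv : v ∈ S
  · rw [hybrid_succ_of_iff (by simp [hv]), if_pos hv]; ring
  · rw [hybrid_univ_succ hv, hybrid_univ, if_neg hv, gainRemove]; ring

/-- Replacing the decision of `A` about `v ∈ A` by that of the pass costs at most `gainAdd`. -/
theorem hybrid_step_of_mem {N : ℕ} {f : Finset (Fin N) → ℝ} (hf : SetSubmodular f)
    (S : Finset (Fin N)) {A : Finset (Fin N)} {v : Fin N} (hA : v ∈ A) :
    -((1 - if v ∈ S then 1 else 0) * gainAdd f S v) ≤
      f (hybrid S A (v + 1)) - f (hybrid S A v) := by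
  by_cases hv : v ∈ S
  · rw [hybrid_succ_of_iff (by simp [hv, hA]), if_pos hv]; simp
  · rw [hybrid_succ_of_notMem hv hA, if_neg hv, gainAdd]
    have hsub : S ∩ Iio v ⊆ hybrid S A (v + 1) := by
      intro u hu
      simp only [mem_inter, mem_Iio, Fin.lt_def] at hu
      rw [mem_hybrid, if_pos (by omega)]
      exact hu.1
    have := hf _ _ hsub v (by simpa [mem_hybrid] using hv)
    linarith

/-- Replacing the decision of `A` about `v ∉ A` by that of the pass costs at most `gainRemove`. -/
theorem hybrid_step_of_notMem {N : ℕ} {f : Finset (Fin N) → ℝ} (hf : SetSubmodular f)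
    (S : Finset (Fin N)) {A : Finset (Fin N)} {v : Fin N} (hA : v ∉ A) :
    -((if v ∈ S then 1 else 0) * gainRemove f S v) ≤
      f (hybrid S A (v + 1)) - f (hybrid S A v) := by
  by_cases hv : v ∈ S
  · rw [hybrid_succ_of_mem A hv, if_pos hv, gainRemove]
    have hsub : hybrid S A v ⊆ (S ∩ Iio v) ∪ Ioi v := by
      intro u hu
      simp only [mem_hybrid, mem_union, mem_inter, mem_Iio, mem_Ioi, Fin.lt_def] at hu ⊢
      rcases lt_trichotomy (u : ℕ) v with h1 | h1 | h1
      · rw [if_pos h1] at hu; exact Or.inl ⟨hu, h1⟩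
      · obtain rfl := Fin.ext h1
        exact absurd (by simpa using hu) hA
      · exact Or.inr h1
    have hins : (S ∩ Iio v) ∪ Ici v = insert v ((S ∩ Iio v) ∪ Ioi v) := by
      rw [← Finset.union_insert, Finset.Ioi_insert]
    have := hf _ _ hsub v (by simp)
    rw [hins]
    linarith
  · rw [hybrid_succ_of_iff (by simp [hv, hA]), if_neg hv]; simp

theorem gainAdd_add_gainRemove_nonneg {N : ℕ} {f : Finset (Fin N) → ℝ} (hf : SetSubmodular f)
    (S : Finset (Fin N)) (v : Fin N) : 0 ≤ gainAdd f S v + gainRemove f S v := by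
  have hins : (S ∩ Iio v) ∪ Ici v = insert v ((S ∩ Iio v) ∪ Ioi v) := by
    rw [← Finset.union_insert, Finset.Ioi_insert]
  have := hf (S ∩ Iio v) ((S ∩ Iio v) ∪ Ioi v) subset_union_left v (by simp)
  rw [gainAdd, gainRemove, hins]
  linarith

/-! ### The learner of a single element -/

/-- The update direction of the learner of `v`. -/
noncomputable def learnerStep {N : ℕ} (f : Finset (Fin N) → ℝ) (p : Fin N → unitInterval)
    (S : Finset (Fin N)) (v : Fin N) : ℝ :=
  (1 - (p v : ℝ)) * gainAdd f S v - (p v : ℝ) * gainRemove f S v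

theorem abs_learnerStep_le {N : ℕ} {f : Finset (Fin N) → ℝ} (hf : ∀ S, f S ∈ Set.Icc (0 : ℝ) 1)
    (p : Fin N → unitInterval) (S : Finset (Fin N)) (v : Fin N) : |learnerStep f p S v| ≤ 1 := by
  have h0 := (p v).2.1
  have h1 := (p v).2.2
  have ha1 : gainAdd f S v ≤ 1 := by
    unfold gainAdd; linarith [(hf (insert v (S ∩ Iio v))).2, (hf (S ∩ Iio v)).1]
  have ha2 : -1 ≤ gainAdd f S v := by
    unfold gainAdd; linarith [(hf (insert v (S ∩ Iio v))).1, (hf (S ∩ Iio v)).2]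
  have hb1 : gainRemove f S v ≤ 1 := by
    unfold gainRemove; linarith [(hf ((S ∩ Iio v) ∪ Ioi v)).2, (hf ((S ∩ Iio v) ∪ Ici v)).1]
  have hb2 : -1 ≤ gainRemove f S v := by
    unfold gainRemove; linarith [(hf ((S ∩ Iio v) ∪ Ioi v)).1, (hf ((S ∩ Iio v) ∪ Ici v)).2]
  have hq : 0 ≤ 1 - (p v : ℝ) := by linarith
  rw [abs_le, learnerStep]
  constructor
  · linarith [mul_le_mul_of_nonneg_left ha2 hq, mul_le_mul_of_nonneg_left hb1 h0]
  · linarith [mul_le_mul_of_nonneg_left ha1 hq, mul_le_mul_of_nonneg_left hb2 h0]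

/-- The anchor of the learner of `v` when the comparison set is `A`. The points `3/4` and `1/4`,
rather than `1` and `0`, make the regret of the pass a quadratic that is dominated by the linear
regret of gradient ascent; see `regret_of_mem` and `regret_of_notMem`. -/
noncomputable def anchor {N : ℕ} (A : Finset (Fin N)) (v : Fin N) : ℝ :=
  if v ∈ A then 3 / 4 else 1 / 4

theorem regret_of_mem {p α β : ℝ} (h : 0 ≤ α + β) :
    (1 - p) * α - (p * α + (1 - p) * β) / 2 ≤ 2 * (3 / 4 - p) * ((1 - p) * α - p * β) := by
  -- The difference of the two sides is `2 (p - 1/2)² (α + β)`.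
  nlinarith [mul_nonneg (sq_nonneg (p - 1 / 2)) h]

theorem regret_of_notMem {p α β : ℝ} (h : 0 ≤ α + β) :
    p * β - (p * α + (1 - p) * β) / 2 ≤ 2 * (1 / 4 - p) * ((1 - p) * α - p * β) := by
  -- The difference of the two sides is `2 (p - 1/2)² (α + β)`.
  nlinarith [mul_nonneg (sq_nonneg (p - 1 / 2)) h]

/-- One step of projected gradient ascent, with the squared distance to the anchor as potential. -/
theorem two_mul_sub_mul_le {c p g η : ℝ} (hc : c ∈ Set.Icc (0 : ℝ) 1) (hη : 0 < η)
    (hg : |g| ≤ 1) :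
    2 * (c - p) * g ≤ (c - p) ^ 2 / η -
      (c - (Set.projIcc (0 : ℝ) 1 zero_le_one (p + η * g) : ℝ)) ^ 2 / η + η := by
  have hproj : (c - (Set.projIcc (0 : ℝ) 1 zero_le_one (p + η * g) : ℝ)) ^ 2 ≤
      (c - (p + η * g)) ^ 2 := by
    rw [Set.coe_projIcc]
    apply sq_le_sq.2
    have := abs_max_sub_max_le_abs (min 1 c) (min 1 (p + η * g)) 0
    have h2 : |min 1 c - min 1 (p + η * g)| ≤ |c - (p + η * g)| := by
      simpa [min_comm] using abs_inf_sub_inf_le_abs c (p + η * g) 1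
    rw [min_eq_right hc.2, max_eq_left hc.1] at this
    rw [min_eq_right hc.2] at h2
    rw [max_comm 0]
    exact this.trans h2
  have hg2 : g ^ 2 ≤ 1 := (sq_le_one_iff_abs_le_one g).2 hg
  have hmul : 2 * (c - p) * g * η ≤ (c - p) ^ 2 -
      (c - (Set.projIcc (0 : ℝ) 1 zero_le_one (p + η * g) : ℝ)) ^ 2 + η * η := by
    nlinarith [mul_le_mul_of_nonneg_left hg2 (mul_pos hη hη).le]
  have : 2 * (c - p) * g ≤ ((c - p) ^ 2 -
      (c - (Set.projIcc (0 : ℝ) 1 zero_le_one (p + η * g) : ℝ)) ^ 2 + η * η) / η :=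
    (le_div_iff₀ hη).2 hmul
  rwa [add_div, sub_div, mul_div_assoc, div_self hη.ne', mul_one] at this

/-- The total potential of the learners, for the comparison set `A` and the step size
`1 / (2 √T)`. -/
noncomputable def potential {N : ℕ} (T : ℕ) (A : Finset (Fin N)) (p : Fin N → unitInterval) : ℝ :=
  ∑ v, (anchor A v - (p v : ℝ)) ^ 2 / (1 / (2 * Real.sqrt T))

theorem potential_nonneg {N : ℕ} (T : ℕ) (A : Finset (Fin N)) (p : Fin N → unitInterval) :
    0 ≤ potential T A p :=
  Finset.sum_nonneg fun _ _ => by positivity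

/-- Half the growth of the values of the lower and the upper set at `v`, minus the bound on what the
decision about `v` costs relative to `A`. The argument `b` stands for the indicator of picking `v`,
or for its probability. -/
noncomputable def stepGain {N : ℕ} (f : Finset (Fin N) → ℝ) (A S : Finset (Fin N)) (v : Fin N)
    (b : ℝ) : ℝ :=
  (b * gainAdd f S v + (1 - b) * gainRemove f S v) / 2 -
    if v ∈ A then (1 - b) * gainAdd f S v else b * gainRemove f S v

/-- Telescoping along the pass for the hybrids of `S` with `A`, `∅` and `univ`, all of which end
in `S`. -/
theorem sum_stepGain_le {N : ℕ} {f : Finset (Fin N) → ℝ} (hf : SetSubmodular f)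
    (h0 : ∀ S, 0 ≤ f S) (A S : Finset (Fin N)) :
    ∑ v, stepGain f A S v (if v ∈ S then 1 else 0) ≤ 2 * f S - f A := by
  have hv : ∀ v, stepGain f A S v (if v ∈ S then 1 else 0) ≤
      (f (hybrid S A (v + 1)) - f (hybrid S A v)) +
      ((f (hybrid S ∅ (v + 1)) - f (hybrid S ∅ v)) +
        (f (hybrid S univ (v + 1)) - f (hybrid S univ v))) / 2 := by
    intro v
    rw [hybrid_empty_step, hybrid_univ_step, stepGain]
    by_cases hA : v ∈ A
    · have := hybrid_step_of_mem hf S hA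
      rw [if_pos hA]; linarith
    · have := hybrid_step_of_notMem hf S hA
      rw [if_neg hA]; linarith
  refine (Finset.sum_le_sum fun v _ => hv v).trans ?_
  rw [Finset.sum_add_distrib, ← Finset.sum_div, Finset.sum_add_distrib, sum_hybrid_sub,
    sum_hybrid_sub, sum_hybrid_sub]
  linarith [h0 ∅, h0 univ]

/-- `stepGain` is affine in `b`, with coefficients that depend only on the elements of `S`
before `v`. -/
theorem sum_pickWeight_mul_stepGain {N : ℕ} (f : Finset (Fin N) → ℝ) (A : Finset (Fin N))
    (p : Fin N → unitInterval) (v : Fin N) :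
    ∑ S, pickWeight p S * stepGain f A S v (if v ∈ S then 1 else 0) =
      ∑ S, pickWeight p S * stepGain f A S v (p v) := by
  have h := sum_pickWeight_mul_indicator p v fun X =>
    ((f (insert v X) - f X) - (f (X ∪ Ioi v) - f (X ∪ Ici v))) / 2 +
      if v ∈ A then f (insert v X) - f X else -(f (X ∪ Ioi v) - f (X ∪ Ici v))
  rw [← sub_eq_zero, ← Finset.sum_sub_distrib]
  refine Eq.trans ?_ h
  refine Finset.sum_congr rfl fun S _ => ?_
  simp only [stepGain, gainAdd, gainRemove]
  by_cases hA : v ∈ A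
  · simp only [hA, if_true]; ring
  · simp only [hA, if_false]; ring

/-- Up to `N / (2 √T)`, the potential grows by no more than the gain of the pass with each decision
replaced by its probability. The bound holds for every drawn `S`, not only in the mean. -/
theorem potential_sub_le_sum_stepGain {N : ℕ} {f : Finset (Fin N) → ℝ} (hf : SetSubmodular f)
    (h01 : ∀ S, f S ∈ Set.Icc (0 : ℝ) 1) {T : ℕ} (hT : 0 < T) (A : Finset (Fin N))
    (p : Fin N → unitInterval) (S : Finset (Fin N)) :
    potential T A (rwUpdate T f p S) - potential T A p - N * (1 / (2 * Real.sqrt T)) ≤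
      ∑ v, stepGain f A S v (p v) := by
  have hη : 0 < 1 / (2 * Real.sqrt T) := by positivity
  have hcard : (N : ℝ) * (1 / (2 * Real.sqrt T)) = ∑ _v : Fin N, 1 / (2 * Real.sqrt T) := by simp
  rw [potential, potential, hcard, ← Finset.sum_sub_distrib, ← Finset.sum_sub_distrib]
  refine Finset.sum_le_sum fun v _ => ?_
  have hc : anchor A v ∈ Set.Icc (0 : ℝ) 1 := by
    unfold anchor; split_ifs <;> constructor <;> norm_num
  have hstep := two_mul_sub_mul_le (p := p v) hc hη (abs_learnerStep_le h01 p S v)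
  have hup : (p v : ℝ) + 1 / (2 * Real.sqrt T) * learnerStep f p S v =
      p v + ((1 - (p v : ℝ)) * gainAdd f S v - (p v : ℝ) * gainRemove f S v) /
        (2 * Real.sqrt T) := by
    unfold learnerStep; ring
  rw [hup] at hstep
  have hab := gainAdd_add_gainRemove_nonneg hf S v
  unfold rwUpdate
  by_cases hA : v ∈ A
  · have := regret_of_mem (p := (p v : ℝ)) hab
    simp only [anchor, stepGain, learnerStep, if_pos hA] at hstep ⊢
    linarith
  · have := regret_of_notMem (p := (p v : ℝ)) hab
    simp only [anchor, stepGain, learnerStep, if_neg hA] at hstep ⊢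
    linarith

/-- One round of the algorithm, from a fixed state `p`: twice the mean reward makes up for the value
of any comparison set, up to the mean change of the potential and `N / (2 √T)`. -/
theorem round_inequality {N : ℕ} {f : Finset (Fin N) → ℝ} (hf : SetSubmodular f)
    (h01 : ∀ S, f S ∈ Set.Icc (0 : ℝ) 1) {T : ℕ} (hT : 0 < T) (A : Finset (Fin N))
    (p : Fin N → unitInterval) :
    f A + ∑ S, pickWeight p S * potential T A (rwUpdate T f p S) ≤
      2 * ∑ S, pickWeight p S * f S + potential T A p + N * (1 / (2 * Real.sqrt T)) := by
  have h1 : ∑ S, pickWeight p S * ∑ v, stepGain f A S v (if v ∈ S then 1 else 0) =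
      ∑ S, pickWeight p S * ∑ v, stepGain f A S v (p v) := by
    simp only [Finset.mul_sum]
    rw [Finset.sum_comm, Finset.sum_comm (s := (univ : Finset (Finset (Fin N))))]
    exact Finset.sum_congr rfl fun v _ => sum_pickWeight_mul_stepGain f A p v
  have h2 : ∑ S, pickWeight p S *
      (potential T A (rwUpdate T f p S) - potential T A p - N * (1 / (2 * Real.sqrt T))) ≤
      ∑ S, pickWeight p S * (2 * f S - f A) := by
    refine (Finset.sum_le_sum fun S _ => mul_le_mul_of_nonneg_left
      (potential_sub_le_sum_stepGain hf h01 hT A p S) (pickWeight_nonneg p S)).trans ?_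
    rw [← h1]
    exact Finset.sum_le_sum fun S _ => mul_le_mul_of_nonneg_left
      (sum_stepGain_le hf (fun S => (h01 S).1) A S) (pickWeight_nonneg p S)
  simp only [mul_sub, Finset.sum_sub_distrib, ← Finset.sum_mul, sum_pickWeight, one_mul,
    mul_left_comm _ (2 : ℝ), ← Finset.mul_sum] at h2
  linarith

/-! ### Expectations over the random state -/

/-- The expectation of a nonnegative function. Values in `[0, ∞]` spare summability conditions over
the uncountable type of states. -/
noncomputable def expect {α : Type*} (q : PMF α) (h : α → ℝ≥0∞) : ℝ≥0∞ :=
  ∑' a, q a * h a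

theorem expect_pure {α : Type*} (a : α) (h : α → ℝ≥0∞) : expect (PMF.pure a) h = h a := by
  rw [expect, tsum_eq_single a fun b hb => by simp [PMF.pure_apply, hb]]
  simp

theorem expect_bind {α β : Type*} (q : PMF α) (κ : α → PMF β) (h : β → ℝ≥0∞) :
    expect (q.bind κ) h = expect q fun a => expect (κ a) h := by
  simp only [expect, PMF.bind_apply, ← ENNReal.tsum_mul_right, ← ENNReal.tsum_mul_left]
  rw [ENNReal.tsum_comm]
  simp only [mul_assoc]

theorem expect_map {α β : Type*} (q : PMF α) (g : α → β) (h : β → ℝ≥0∞) :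
    expect (q.map g) h = expect q fun a => h (g a) := by
  rw [PMF.map, expect_bind]
  simp only [Function.comp_apply, expect_pure]

theorem expect_mono {α : Type*} (q : PMF α) {g h : α → ℝ≥0∞} (hgh : ∀ a, g a ≤ h a) :
    expect q g ≤ expect q h :=
  ENNReal.tsum_le_tsum fun a => mul_le_mul_right (hgh a) _

theorem expect_add {α : Type*} (q : PMF α) (g h : α → ℝ≥0∞) :
    expect q (fun a => g a + h a) = expect q g + expect q h := by
  simp only [expect, mul_add, ENNReal.tsum_add]

theorem expect_const {α : Type*} (q : PMF α) (c : ℝ≥0∞) : expect q (fun _ => c) = c := by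
  rw [expect, ENNReal.tsum_mul_right, q.tsum_coe, one_mul]

theorem expect_const_mul {α : Type*} (q : PMF α) (c : ℝ≥0∞) (h : α → ℝ≥0∞) :
    expect q (fun a => c * h a) = c * expect q h := by
  simp only [expect, mul_left_comm _ c, ENNReal.tsum_mul_left]

theorem expect_pickLaw {N : ℕ} (p : Fin N → unitInterval) {h : Finset (Fin N) → ℝ}
    (hh : ∀ S, 0 ≤ h S) :
    expect (pickLaw p) (fun S => ENNReal.ofReal (h S)) =
      ENNReal.ofReal (∑ S, pickWeight p S * h S) := by
  rw [expect, tsum_fintype,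
    ENNReal.ofReal_sum_of_nonneg fun S _ => mul_nonneg (pickWeight_nonneg p S) (hh S)]
  refine Finset.sum_congr rfl fun S _ => ?_
  rw [ENNReal.ofReal_mul (pickWeight_nonneg p S)]
  rfl

theorem expect_toReal {N : ℕ} (q : PMF (Finset (Fin N))) {h : Finset (Fin N) → ℝ}
    (hh : ∀ S, 0 ≤ h S) :
    expect q (fun S => ENNReal.ofReal (h S)) = ENNReal.ofReal (∑ S, (q S).toReal * h S) := by
  rw [expect, tsum_fintype,
    ENNReal.ofReal_sum_of_nonneg fun S _ => mul_nonneg ENNReal.toReal_nonneg (hh S)]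
  refine Finset.sum_congr rfl fun S _ => ?_
  rw [ENNReal.ofReal_mul ENNReal.toReal_nonneg, ENNReal.ofReal_toReal (q.apply_ne_top S)]

theorem expect_round_inequality {N : ℕ} {f : ℕ → Finset (Fin N) → ℝ} {T t : ℕ} (hT : 0 < T)
    (hf : SetSubmodular (f t)) (h01 : ∀ S, f t S ∈ Set.Icc (0 : ℝ) 1) (A : Finset (Fin N)) :
    ENNReal.ofReal (f t A) +
        expect (rwStateLaw T f (t + 1)) (fun p => ENNReal.ofReal (potential T A p)) ≤
      2 * expect (rwLaw T f t) (fun S => ENNReal.ofReal (f t S)) +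
        expect (rwStateLaw T f t) (fun p => ENNReal.ofReal (potential T A p)) +
        ENNReal.ofReal (N * (1 / (2 * Real.sqrt T))) := by
  rw [rwStateLaw, rwLaw, expect_bind, expect_bind,
    ← expect_const (rwStateLaw T f t) (ENNReal.ofReal (f t A)),
    ← expect_const (rwStateLaw T f t) (ENNReal.ofReal (N * (1 / (2 * Real.sqrt T)))),
    ← expect_const_mul, ← expect_add, ← expect_add, ← expect_add]
  refine expect_mono _ fun p => ?_
  have hs : ∀ h : Finset (Fin N) → ℝ, (∀ S, 0 ≤ h S) → 0 ≤ ∑ S, pickWeight p S * h S :=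
    fun h hh => Finset.sum_nonneg fun S _ => mul_nonneg (pickWeight_nonneg p S) (hh S)
  have hη : 0 ≤ (N : ℝ) * (1 / (2 * Real.sqrt T)) := by positivity
  have hpot := potential_nonneg T A p
  have hfs := hs (f t) fun S => (h01 S).1
  rw [expect_map, expect_pickLaw p fun S => potential_nonneg T A _,
    expect_pickLaw p fun S => (h01 S).1, ← ENNReal.ofReal_ofNat 2,
    ← ENNReal.ofReal_mul (by norm_num), ← ENNReal.ofReal_add (by positivity) hpot,
    ← ENNReal.ofReal_add (by positivity) hη,
    ← ENNReal.ofReal_add (h01 A).1 (hs _ fun S => potential_nonneg T A _)]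
  exact ENNReal.ofReal_le_ofReal (round_inequality hf h01 hT A p)

theorem sum_round_inequality {N : ℕ} {f : ℕ → Finset (Fin N) → ℝ} {T : ℕ}
    (hf : ∀ t < T, SetSubmodular (f t)) (h01 : ∀ t < T, ∀ S, f t S ∈ Set.Icc (0 : ℝ) 1)
    (A : Finset (Fin N)) {t : ℕ} (ht : t ≤ T) :
    ∑ s ∈ range t, ENNReal.ofReal (f s A) +
        expect (rwStateLaw T f t) (fun p => ENNReal.ofReal (potential T A p)) ≤
      2 * ∑ s ∈ range t, expect (rwLaw T f s) (fun S => ENNReal.ofReal (f s S)) +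
        ENNReal.ofReal (potential T A (rwInit N)) +
        t * ENNReal.ofReal (N * (1 / (2 * Real.sqrt T))) := by
  induction t with
  | zero => simp [rwStateLaw, expect_pure]
  | succ t ih =>
    have h1 := ih (by omega)
    have h2 := expect_round_inequality (t := t) (Nat.zero_lt_of_lt ht) (hf t ht) (h01 t ht) A
    rw [Finset.sum_range_succ, Finset.sum_range_succ, add_assoc]
    refine (add_le_add_right h2 _).trans ?_
    rw [← add_assoc, add_left_comm]
    refine (add_le_add_left (add_le_add_right h1 _) _).trans (le_of_eq ?_)
    push_cast
    ring

theorem potential_rwInit {N T : ℕ} (A : Finset (Fin N)) :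
    potential T A (rwInit N) = N * Real.sqrt T / 8 := by
  have : ∀ v, (anchor A v - (rwInit N v : ℝ)) ^ 2 / (1 / (2 * Real.sqrt T)) = Real.sqrt T / 8 := by
    intro v
    have h : (anchor A v - (rwInit N v : ℝ)) ^ 2 = 1 / 16 := by
      simp only [anchor, rwInit]; split_ifs <;> norm_num
    rw [h, one_div (2 * Real.sqrt T), div_inv_eq_mul]
    ring
  rw [potential, Finset.sum_congr rfl fun v _ => this v]
  simp
  ring

/-- The `1/2`-regret bound of the Roughgarden–Wang algorithm for submodular set functions. -/
theorem rwLaw_regret {N : ℕ} {f : ℕ → Finset (Fin N) → ℝ} {T : ℕ} (hT : 0 < T)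
    (hf : ∀ t < T, SetSubmodular (f t)) (h01 : ∀ t < T, ∀ S, f t S ∈ Set.Icc (0 : ℝ) 1)
    (A : Finset (Fin N)) :
    ∑ t ∈ range T, f t A ≤
      2 * ∑ t ∈ range T, ∑ S, (rwLaw T f t S).toReal * f t S + 5 / 8 * (N * Real.sqrt T) := by
  have h := le_self_add.trans (sum_round_inequality hf h01 A le_rfl)
  have hE : ∀ t ∈ range T, 0 ≤ ∑ S, (rwLaw T f t S).toReal * f t S := fun t ht =>
    Finset.sum_nonneg fun S _ => mul_nonneg ENNReal.toReal_nonneg (h01 t (mem_range.1 ht) S).1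
  rw [Finset.sum_congr rfl fun t ht =>
      expect_toReal (rwLaw T f t) fun S => (h01 t (mem_range.1 ht) S).1,
    ← ENNReal.ofReal_sum_of_nonneg fun t ht => (h01 t (mem_range.1 ht) A).1,
    ← ENNReal.ofReal_sum_of_nonneg hE, ← ENNReal.ofReal_ofNat 2,
    ← ENNReal.ofReal_natCast T, ← ENNReal.ofReal_mul (by norm_num),
    ← ENNReal.ofReal_mul (by positivity),
    ← ENNReal.ofReal_add (mul_nonneg (by norm_num) (Finset.sum_nonneg hE)) (potential_nonneg T A _),
    ← ENNReal.ofReal_add (add_nonneg (mul_nonneg (by norm_num) (Finset.sum_nonneg hE))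
      (potential_nonneg T A _)) (by positivity),
    ENNReal.ofReal_le_ofReal_iff (add_nonneg (add_nonneg (mul_nonneg (by norm_num)
      (Finset.sum_nonneg hE)) (potential_nonneg T A _)) (by positivity)), potential_rwInit] at h
  have hs : (T : ℝ) * (N * (1 / (2 * Real.sqrt T))) = N * Real.sqrt T / 2 := by
    have h1 : 0 < Real.sqrt T := Real.sqrt_pos.2 (by exact_mod_cast hT)
    have h2 : (T : ℝ) = Real.sqrt T * Real.sqrt T := (Real.mul_self_sqrt (by positivity)).symm
    field_simp
    rw [sq, ← h2]
    ring
  linarith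

/-! ### Lifting -/

theorem bitWeight_pos (M : ℕ) (j : Fin (M + 1)) : 0 < bitWeight M j := by
  unfold bitWeight; split_ifs <;> positivity

theorem sum_geometric_half (M : ℕ) : ∑ j ∈ range M, ((1 : ℝ) / 2) ^ (j + 1) = 1 - (1 / 2) ^ M := by
  induction M with
  | zero => simp
  | succ M ih => rw [Finset.sum_range_succ, ih]; ring

theorem sum_bitWeight (M : ℕ) : ∑ j, bitWeight M j = 1 := by
  rw [Fin.sum_univ_succ]
  simp only [bitWeight, if_true, Fin.succ_ne_zero, if_false, Fin.val_succ]
  rw [Fin.sum_univ_eq_sum_range (fun j => ((1 : ℝ) / 2) ^ (j + 1)), sum_geometric_half]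
  ring

theorem decode_mem_cube (n M : ℕ) (S : Finset (Fin (n * (M + 1)))) : decode n M S ∈ cube n := by
  intro i
  simp only [decode]
  constructor
  · exact Finset.sum_nonneg fun j _ => by split_ifs <;> simp [(bitWeight_pos M j).le]
  · rw [← sum_bitWeight M]
    exact Finset.sum_le_sum fun j _ => by split_ifs <;> simp [(bitWeight_pos M j).le]

theorem decode_mono {n M : ℕ} {A B : Finset (Fin (n * (M + 1)))} (h : A ⊆ B) (i : Fin n) :
    decode n M A i ≤ decode n M B i := by
  simp only [decode]
  refine Finset.sum_le_sum fun j _ => ?_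
  by_cases hA : finProdFinEquiv (i, j) ∈ A
  · simp [hA, h hA]
  · simp only [hA, if_false]; split_ifs <;> simp [(bitWeight_pos M j).le]

theorem decode_insert {n M : ℕ} {A : Finset (Fin (n * (M + 1)))} {i : Fin n} {j : Fin (M + 1)}
    (h : finProdFinEquiv (i, j) ∉ A) :
    decode n M (insert (finProdFinEquiv (i, j)) A) =
      decode n M A + EuclideanSpace.single i (bitWeight M j) := by
  ext k
  simp only [decode, PiLp.add_apply, PiLp.single_apply]
  have hterm : ∀ l, (if finProdFinEquiv (k, l) ∈ insert (finProdFinEquiv (i, j)) A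
      then bitWeight M l else 0) =
      (if finProdFinEquiv (k, l) ∈ A then bitWeight M l else 0) +
        if l = j then (if k = i then bitWeight M j else 0) else 0 := by
    intro l
    by_cases hk : k = i
    · by_cases hl : l = j
      · subst hk hl; simp [h]
      · simp [hl, Prod.ext_iff]
    · simp [hk, Prod.ext_iff]
  rw [Finset.sum_congr rfl fun l _ => hterm l, Finset.sum_add_distrib]
  simp

/-- Diminishing returns along the coordinate directions give a submodular lifted function. -/
theorem DRSubmodular.setSubmodular_liftFn {n : ℕ} {F : EuclideanSpace ℝ (Fin n) → ℝ}
    (hF : DRSubmodular F) (M : ℕ) : SetSubmodular (liftFn n M F) := by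
  intro A B hAB v hv
  obtain ⟨⟨i, j⟩, rfl⟩ := finProdFinEquiv.surjective v
  have hA := decode_insert (fun h => hv (hAB h))
  have hB := decode_insert hv
  unfold liftFn
  rw [hA, hB]
  exact hF _ (decode_mem_cube n M B) _ (decode_mem_cube n M A) (decode_mono hAB) i _
    (bitWeight_pos M j) (hB ▸ decode_mem_cube n M _) (hA ▸ decode_mem_cube n M _)

/-- Binary expansion to `M` digits. -/
theorem exists_binary_digits {x : ℝ} (hx : x ∈ Set.Icc (0 : ℝ) 1) (M : ℕ) :
    ∃ D : Finset ℕ, |x - ∑ j ∈ range M, (if j ∈ D then ((1 : ℝ) / 2) ^ (j + 1) else 0)| ≤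
      (1 / 2) ^ M := by
  suffices h : ∃ D : Finset ℕ, (∀ j ∈ D, j < M) ∧
      0 ≤ x - ∑ j ∈ range M, (if j ∈ D then ((1 : ℝ) / 2) ^ (j + 1) else 0) ∧
      x - ∑ j ∈ range M, (if j ∈ D then ((1 : ℝ) / 2) ^ (j + 1) else 0) ≤ (1 / 2) ^ M by
    obtain ⟨D, -, h0, h1⟩ := h
    exact ⟨D, by rwa [abs_of_nonneg h0]⟩
  induction M with
  | zero => exact ⟨∅, by simpa using hx⟩
  | succ M ih =>
    obtain ⟨D, hD, h0, h1⟩ := ih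
    -- The next digit is set exactly when the remainder is at least `2^{-(M+1)}`.
    by_cases hd : ((1 : ℝ) / 2) ^ (M + 1) ≤
        x - ∑ j ∈ range M, (if j ∈ D then ((1 : ℝ) / 2) ^ (j + 1) else 0)
    · have hs : ∑ j ∈ range M, (if j ∈ insert M D then ((1 : ℝ) / 2) ^ (j + 1) else 0) =
          ∑ j ∈ range M, (if j ∈ D then ((1 : ℝ) / 2) ^ (j + 1) else 0) :=
        Finset.sum_congr rfl fun j hj => by simp [(mem_range.1 hj).ne]
      refine ⟨insert M D, fun j hj => ?_, ?_, ?_⟩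
      · rcases mem_insert.1 hj with rfl | hj
        · omega
        · have := hD j hj; omega
      all_goals
        rw [Finset.sum_range_succ, hs, if_pos (mem_insert_self M D)]
        rw [pow_succ] at hd ⊢
        linarith
    · have hM : M ∉ D := fun h => lt_irrefl _ (hD M h)
      refine ⟨D, fun j hj => (hD j hj).trans M.lt_succ_self, ?_, ?_⟩
      all_goals
        rw [Finset.sum_range_succ, if_neg hM, add_zero]
        linarith

/-- Every point of the cube is within `n 2^{-M}` of the lattice; the extra bit `0` is not needed. -/
theorem exists_decode_near {n : ℕ} {x : EuclideanSpace ℝ (Fin n)} (hx : x ∈ cube n) (M : ℕ) :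
    ∃ A, ‖x - decode n M A‖ ≤ n * (1 / 2) ^ M := by
  choose D hD using fun i => exists_binary_digits (hx i) M
  let A : Finset (Fin (n * (M + 1))) := {v |
    (finProdFinEquiv.symm v).2 ≠ 0 ∧
      ((finProdFinEquiv.symm v).2 : ℕ) - 1 ∈ D (finProdFinEquiv.symm v).1}
  refine ⟨A, ?_⟩
  have hmem : ∀ i j, finProdFinEquiv (i, j) ∈ A ↔ j ≠ 0 ∧ (j : ℕ) - 1 ∈ D i := by
    intro i j
    simp only [A, Finset.mem_filter_univ, Equiv.symm_apply_apply]
  have hcoord : ∀ i, |x i - decode n M A i| ≤ (1 / 2) ^ M := by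
    intro i
    refine le_of_eq_of_le ?_ (hD i)
    congr 2
    simp only [decode]
    rw [Fin.sum_univ_succ,
      ← Fin.sum_univ_eq_sum_range (fun j => if j ∈ D i then ((1 : ℝ) / 2) ^ (j + 1) else 0)]
    simp [hmem, bitWeight]
  calc ‖x - decode n M A‖ = ‖∑ i, EuclideanSpace.single i ((x - decode n M A) i)‖ := by
        congr 1
        ext k
        simp
    _ ≤ ∑ i, ‖EuclideanSpace.single i ((x - decode n M A) i)‖ := norm_sum_le _ _
    _ ≤ ∑ _i : Fin n, (1 / 2 : ℝ) ^ M := by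
        refine Finset.sum_le_sum fun i _ => ?_
        rw [PiLp.norm_single, Real.norm_eq_abs]
        exact hcoord i
    _ = n * (1 / 2) ^ M := by simp

/-! ### Compactness and the number of bits -/

theorem isCompact_cube (n : ℕ) : IsCompact (cube n) := by
  have h : cube n = WithLp.ofLp ⁻¹' (Set.univ.pi fun _ : Fin n => Set.Icc (0 : ℝ) 1) := by
    ext x; simp only [cube, Set.mem_ofPred_eq, Set.mem_preimage, Set.mem_univ_pi]
  rw [h]
  exact (PiLp.homeomorph 2 (fun _ : Fin n => ℝ)).isCompact_preimage.2
    (isCompact_univ_pi fun _ => isCompact_Icc)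

theorem clog_two_le_log {T : ℕ} (hT : 2 ≤ T) : (Nat.clog 2 T : ℝ) + 1 ≤ 6 * Real.log T := by
  have hlog2 : 1 / 2 < Real.log 2 := by linarith [Real.log_two_gt_d9]
  have hpow : 2 ^ (Nat.clog 2 T - 1) < T := Nat.pow_pred_clog_lt_self one_lt_two (by omega)
  have hpos := Nat.clog_pos one_lt_two hT
  have h1 : ((Nat.clog 2 T - 1 : ℕ) : ℝ) * Real.log 2 ≤ Real.log T := by
    rw [← Real.log_pow]
    exact Real.log_le_log (by positivity) (by exact_mod_cast hpow.le)
  have h2 : Real.log 2 ≤ Real.log T := Real.log_le_log (by norm_num) (by exact_mod_cast hT)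
  rw [Nat.cast_pred hpos] at h1
  have h3 : (1 : ℝ) ≤ Nat.clog 2 T := by exact_mod_cast hpos
  nlinarith [mul_nonneg (sub_nonneg.2 h3) (sub_nonneg.2 hlog2.le)]

/-! ### The algorithm on the hypercube -/

/-- The given point `x₀` of the first round replaces the random set of the Roughgarden–Wang
algorithm. This costs at most `1 ≤ n`, and nothing for `n = 0`, where the cube is a point. -/
theorem sum_rwLaw_sub_le_sum_expectedReward {n T : ℕ} (hT : 0 < T) (M : ℕ)
    {F : ℕ → EuclideanSpace ℝ (Fin n) → ℝ}
    (h01 : ∀ x ∈ cube n, F 0 x ∈ Set.Icc (0 : ℝ) 1)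
    {x₀ : EuclideanSpace ℝ (Fin n)} (hx₀ : x₀ ∈ cube n) :
    ∑ t ∈ range T, ∑ S, (rwLaw T (fun s => liftFn n M (F s)) t S).toReal * liftFn n M (F t) S - n ≤
      ∑ t ∈ range T, expectedReward n M T F x₀ t := by
  obtain ⟨T, rfl⟩ := Nat.exists_eq_succ_of_ne_zero hT.ne'
  set q := rwLaw (T + 1) (fun s => liftFn n M (F s)) 0
  have hle : ∀ S, liftFn n M (F 0) S ≤ F 0 x₀ + n := by
    intro S
    rcases Nat.eq_zero_or_pos n with rfl | hn
    · have : decode 0 M S = x₀ := Subsingleton.elim _ _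
      simp [liftFn, this]
    · have hn1 : (1 : ℝ) ≤ n := by exact_mod_cast hn
      have h1 := (h01 _ (decode_mem_cube n M S)).2
      have h2 := (h01 _ hx₀).1
      unfold liftFn
      linarith
  have hq : ∑ S, (q S).toReal = 1 := by
    rw [← ENNReal.toReal_sum fun S _ => q.apply_ne_top S, ← tsum_fintype (L := .unconditional _),
      q.tsum_coe, ENNReal.toReal_one]
  have h0 : ∑ S, (q S).toReal * liftFn n M (F 0) S ≤ F 0 x₀ + n := by
    refine (Finset.sum_le_sum fun S _ =>
      mul_le_mul_of_nonneg_left (hle S) ENNReal.toReal_nonneg).trans ?_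
    rw [← Finset.sum_mul, hq, one_mul]
  rw [Finset.sum_range_succ', Finset.sum_range_succ']
  simp only [expectedReward, liftFn] at h0 ⊢
  linarith

end OnlineDR

theorem mainTheorem2 :
    ∃ C : ℝ, 0 < C ∧
      ∀ (n T : ℕ), 2 ≤ T →
      ∀ (G : NNReal) (F : ℕ → EuclideanSpace ℝ (Fin n) → ℝ),
        (∀ t < T, ∀ x ∈ OnlineDR.cube n, F t x ∈ Set.Icc (0 : ℝ) 1) →
        (∀ t < T, OnlineDR.DRSubmodular (F t)) →
        (∀ t < T, LipschitzOnWith G (F t) (OnlineDR.cube n)) →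
      ∀ x₀ ∈ OnlineDR.cube n,
      ∃ xs ∈ OnlineDR.cube n,
        IsMaxOn (fun x => ∑ t ∈ Finset.range T, F t x) (OnlineDR.cube n) xs ∧
        (1 / 2 : ℝ) * ∑ t ∈ Finset.range T, F t xs
            - C * (n * max 1 (G : ℝ) * Real.sqrt T * Real.log T)
          ≤ ∑ t ∈ Finset.range T, OnlineDR.expectedReward n (Nat.clog 2 T) T F x₀ t := by
  refine ⟨5, by norm_num, fun n T hT G F h01 hDR hLip x₀ hx₀ => ?_⟩
  have hcont : ContinuousOn (fun x => ∑ t ∈ Finset.range T, F t x) (OnlineDR.cube n) :=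
    continuousOn_finsetSum _ fun t ht => (hLip t (mem_range.1 ht)).continuousOn
  obtain ⟨xs, hxs, hmax⟩ := (OnlineDR.isCompact_cube n).exists_isMaxOn ⟨x₀, hx₀⟩ hcont
  refine ⟨xs, hxs, hmax, ?_⟩
  set M := Nat.clog 2 T with hM
  obtain ⟨A, hA⟩ := OnlineDR.exists_decode_near hxs M
  have hTpos : (0 : ℝ) < T := by exact_mod_cast (by omega : 0 < T)
  -- Rounding `xs` to the lattice costs `n G / T` per round, since `2 ^ M ≥ T`.
  have hpow : (1 / 2 : ℝ) ^ M ≤ 1 / T := by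
    rw [one_div_pow]
    exact one_div_le_one_div_of_le hTpos (by exact_mod_cast Nat.le_pow_clog one_lt_two T)
  have hround : ∑ t ∈ range T, F t xs ≤
      ∑ t ∈ range T, OnlineDR.liftFn n M (F t) A + n * G := by
    have hstep : ∀ t ∈ range T, F t xs ≤ OnlineDR.liftFn n M (F t) A + G * (n * (1 / T)) := by
      intro t ht
      have h1 := (hLip t (mem_range.1 ht)).dist_le_mul xs hxs _ (OnlineDR.decode_mem_cube n M A)
      rw [Real.dist_eq, dist_eq_norm] at h1
      have h2 : ‖xs - OnlineDR.decode n M A‖ ≤ n * (1 / T) :=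
        hA.trans (mul_le_mul_of_nonneg_left hpow n.cast_nonneg)
      have h3 := (le_abs_self _).trans (h1.trans (mul_le_mul_of_nonneg_left h2 G.coe_nonneg))
      unfold OnlineDR.liftFn
      linarith
    refine (Finset.sum_le_sum hstep).trans (le_of_eq ?_)
    rw [Finset.sum_add_distrib, Finset.sum_const, card_range, nsmul_eq_mul]
    field_simp
  have hreg := OnlineDR.rwLaw_regret (f := fun t => OnlineDR.liftFn n M (F t)) (by omega : 0 < T)
    (fun t ht => (hDR t ht).setSubmodular_liftFn M)
    (fun t ht S => h01 t ht _ (OnlineDR.decode_mem_cube n M S)) A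
  have hrew := OnlineDR.sum_rwLaw_sub_le_sum_expectedReward (by omega : 0 < T) M
    (h01 0 (by omega)) hx₀
  -- All three losses, `n G / 2`, `n` and `5/16 · n (M + 1) √T`, are multiples of `B`.
  set B := (n : ℝ) * max 1 (G : ℝ) * Real.sqrt T * Real.log T with hB
  have hlog := OnlineDR.clog_two_le_log hT
  have hn0 : (0 : ℝ) ≤ n := n.cast_nonneg
  have hs1 : 7 / 5 ≤ Real.sqrt T := by
    apply Real.le_sqrt_of_sq_le
    have : (2 : ℝ) ≤ T := by exact_mod_cast hT
    norm_num
    linarith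
  have hl1 : 0.69 ≤ Real.log T := by
    have : Real.log 2 ≤ Real.log T := Real.log_le_log (by norm_num) (by exact_mod_cast hT)
    linarith [Real.log_two_gt_d9]
  have hsl : 9 / 10 ≤ Real.sqrt T * Real.log T := by nlinarith
  have hm1 : 1 ≤ max 1 (G : ℝ) := le_max_left _ _
  have hmG : (G : ℝ) ≤ max 1 (G : ℝ) := le_max_right _ _
  have hnm : (n : ℝ) ≤ n * max 1 (G : ℝ) := le_mul_of_one_le_right hn0 hm1
  have hnG : (n : ℝ) * G ≤ n * max 1 (G : ℝ) := mul_le_mul_of_nonneg_left hmG hn0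
  have hB1 : 9 / 10 * ((n : ℝ) * max 1 (G : ℝ)) ≤ B := by
    have := mul_le_mul_of_nonneg_left hsl (hn0.trans hnm)
    rw [hB]; linarith
  have hB2 : ((n * (M + 1) : ℕ) : ℝ) * Real.sqrt T ≤ 6 * B := by
    have h1 : ((n * (M + 1) : ℕ) : ℝ) ≤ n * max 1 (G : ℝ) * (6 * Real.log T) := by
      push_cast
      exact mul_le_mul hnm hlog (by positivity) (hn0.trans hnm)
    have := mul_le_mul_of_nonneg_right h1 (Real.sqrt_nonneg T)
    rw [hB]; linarith
  linarith
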